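/- Let $\mathcal E$ be a finite set of strings, i.e. simple (non-closed, non-self-crossing) arcs on the sphere, with pairwise distinct ends, such that any two arcs meet only in finitely many proper crossings, no three arcs share a crossing, the union of the arcs is connected, and there is at least one crossing. Ground $\mathcal E$: in every face of $\mathcal E$ in which strings end, draw one simple closed boundary curve on which all these strings end, and which meets $\mathcal E$ only there. The dual net $\mathcal N=(V,E)$ is the plane (multi)graph with one vertex for each cell of strings and boundary curves (other than the cells inside the boundary curves) and one edge for each piece of string between consecutive crossings or ends, joining the cells on the two sides of the piece. Each crossing is enclosed by one square face of $\mathcal N$; the other faces are the boundary-holes, bounded by the boundary curves. The border consists of the edges crossing a piece of string that ends on a boundary curve (these are drawn on the boundary curves), together with their end-vertices. All other edges and vertices are interior. An interior vertex is regular if it has degree $4$, and a vertex-hole otherwise. A vertex is on a hole if it is a vertex-hole or a border vertex. A straight path is a path of interior edges of $\mathcal N$, without repeated edges, all of whose non-end vertices are regular and in which any two consecutive edges are opposite at their common vertex (its two ends may coincide). A cut-set is a set $\mathcal S$ of pairwise edge-disjoint straight paths (segments) such that every end of a segment is on a hole or in the interior of another segment of $\mathcal S$. Let $B$ be the set of border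 edges and $E_0$ the set of edges of the segments. A vertex $v$ is saturated if either $v$ is regular and no edge of $E_0$ is incident with $v$, or at least one edge of $E_0\cup B$ is incident with $v$ and every angle at $v$ between rotationally consecutive edges of $E_0\cup B$ (the full angle if there is only one such edge-end) sees at most two squares, counted with multiplicity. $\mathcal S$ is saturating if every vertex is saturated. A rectangle is a set of distinct squares arranged as an $n\times m$ grid ($n,m\ge1$): each square has its sides called right, top, left, bottom in counterclockwise order, the right side of each square is the left side of the next square in its row, and the top side of each square is the bottom side of the next square in its column. The edges used in this way are the inner edges of the rectangle. A rectangulation $\mathcal R$ is a set of rectangles such that every square belongs to exactly one of them. An interior edge of $\mathcal N$ is separating for $\mathcal R$ if it is not an inner edge of a rectangle of $\mathcal R$. $\mathcal S$ delimits $\mathcal R$ if the edges of its segments are exactly the edges that are separating for $\mathcal R$. Then a cut-set $\mathcal S$ is saturating if and only if it delimits some rectangulation. Moreover, if no two strings of $\mathcal E$ cross more than once, then $\mathcal S$ is saturating if and only if there is a partition of the squares into sets, each of which can be arranged as a rectangle, such that the edges of the segments of $\mathcal S$ are exactly the edges that lie on the boundary of two squares in different parts. -/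

import Mathlib

/-!
# Sets of strings, dual nets, cut-sets and rectangulations

A connected set of strings on the sphere is given, up to homeomorphism, by the combinatorial map of
its planarization.  A *dart* is a pair of a crossing and one of the four directions in which a
string leaves it.

* `rot` sends a dart to the next dart, counterclockwise, at the same crossing; every crossing has
  exactly four darts, and `rot (rot d)` is the straight continuation of `d` through the crossing.
* `glue` is an involution.  If the piece of string that starts with the dart `d` runs to another
  crossing (or back to the same one), then `glue d` is the dart from which this piece is seen at its
  other end.  If the piece runs to an end of its string, then `glue d = d`.

The boundary curves of the grounding need not be recorded: there is exactly one in every face of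
the strings in which some string ends, and all strings ending in that face end on that curve.
-/

/-- The combinatorial map of a family of curves that cross each other in four-valent crossings and
whose ends are free. -/
structure CrossingMap (D : Type*) where
  rot : Equiv.Perm D
  rot_four : ∀ d, rot (rot (rot (rot d))) = d
  rot_two_ne : ∀ d, rot (rot d) ≠ d
  glue : D → D
  glue_glue : ∀ d, glue (glue d) = d

namespace CrossingMap

variable {D : Type*} (M : CrossingMap D)

/-! ### The strings -/

/-- The next corner around the same face of the curves.  The *corner* named by a dart `d` is the
corner between the directions `d` and `rot d`. -/
def next (d : D) : D := M.glue (M.rot d)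

/-- Two darts lie on the same curve: generated by following a piece of curve and by passing straight
through a crossing. -/
def SameString : D → D → Prop :=
  Relation.EqvGen (fun a b => b = M.glue a ∨ b = M.rot (M.rot a))

/-- Two darts lie in the same connected component of the union of the curves. -/
def SameComponent : D → D → Prop :=
  Relation.EqvGen (fun a b => b = M.glue a ∨ b = M.rot a)

/-- The squares of the dual net; each encloses one crossing. The side of the square that is crossed
by the direction `d` is also called the side `d`. -/
def Square : Type _ := Quot (fun a b => b = M.rot a)

/-- The edges of the dual net; each crosses one piece of string. -/
def Edge : Type _ := Quot (fun a b => b = M.glue a)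

/-- The faces of the set of strings (the boundary curves are not taken into account). -/
def Face : Type _ := Quot (fun a b => b = M.next a)

/-- The vertices of the dual net, that is, the cells of the strings together with the boundary
curves (without the cells inside boundary curves).  Walking around a face one stays in the same
cell, except when one comes to an end of a string, which lies on the boundary curve. -/
def Vertex : Type _ := Quot (fun a b => M.glue (M.rot a) ≠ M.rot a ∧ b = M.next a)

/-- The square around the crossing of a dart. -/
def square (d : D) : M.Square := Quot.mk _ d

/-- The edge of the net that crosses the piece of string starting with `d`. -/
def edge (d : D) : M.Edge := Quot.mk _ d

/-- The edge `d` of the net is traversed so that the square of `d` is on the left. Then it ends in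
the cell that contains the corner `d`. -/
def head (d : D) : M.Vertex := Quot.mk _ d

/-- The vertex in which the edge `d` starts, when it is traversed as for `head`. -/
def tail (d : D) : M.Vertex := M.head (M.rot.symm d)

/-- The edges of the net on the border: they cross the last piece of a string, between its last
crossing and its end on a boundary curve. -/
def border : Set M.Edge := {e | ∃ d, M.edge d = e ∧ M.glue d = d}

/-- The curves form a connected set of strings: finitely many simple arcs on the sphere with
distinct ends, whose union is connected and has at least one crossing. -/
structure IsStringSet : Prop where
  connected : ∀ a b, M.SameComponent a b
  /-- no curve crosses itself -/
  simple : ∀ d, ¬ M.SameString d (M.rot d)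
  /-- no curve is closed -/
  not_closed : ∀ d, ∃ d', M.SameString d d' ∧ M.glue d' = d'
  /-- Euler's formula, for the graph whose vertices are the crossings and whose edges are the pieces
  of strings between crossings -/
  planar : Nat.card M.Square + Nat.card M.Face = Nat.card {e : M.Edge // e ∉ M.border} + 2

/-- No two strings cross more than once. -/
def IsPseudosegments : Prop :=
  ∀ d d', M.SameString d d' → M.SameString (M.rot d) (M.rot d') → M.square d = M.square d'

/-! ### Vertices of the dual net -/

/-- The edge `e` is incident with the vertex `v`. -/
def Incident (e : M.Edge) (v : M.Vertex) : Prop :=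
  ∃ d, M.edge d = e ∧ (M.tail d = v ∨ M.head d = v)

/-- The vertex `v` is drawn on a boundary curve. -/
def IsBorderVertex (v : M.Vertex) : Prop := ∃ e ∈ M.border, M.Incident e v

/-- The degree of a vertex of the net, loops counting twice.  An interior edge occurs with two darts,
one for each direction; an edge on the border occurs with one dart only. -/
noncomputable def degree (v : M.Vertex) : ℕ :=
  {d | M.tail d = v}.ncard + {d | M.glue d = d ∧ M.head d = v}.ncard

/-- An interior vertex of degree four. -/
def IsRegular (v : M.Vertex) : Prop := ¬ M.IsBorderVertex v ∧ M.degree v = 4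

/-- An interior vertex whose degree is not four. -/
def IsVertexHole (v : M.Vertex) : Prop := ¬ M.IsBorderVertex v ∧ M.degree v ≠ 4

/-- The vertex is a vertex-hole or lies on (the boundary of) a boundary-hole. -/
def IsOnHole (v : M.Vertex) : Prop := M.IsVertexHole v ∨ M.IsBorderVertex v

/-! ### Cut-sets -/

/-- A straight path of interior edges of the net, as the list of its edges, each traversed in the
direction of the path with its dart's square on the left.  The edges that leave the vertex `head a`
are, in rotational order, the reverse of `a`, then `rot a`, and then `rot (next a)`; the last one is
the edge opposite to `a` if the vertex is regular. -/
structure IsStraightPath (p : List D) : Prop where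
  ne_nil : p ≠ []
  interior : ∀ d ∈ p, M.edge d ∉ M.border
  straight : p.IsChain (fun a b => M.IsRegular (M.head a) ∧ b = M.rot (M.next a))
  nodup : (p.map M.edge).Nodup

/-- The edges of a path. -/
def pathEdges (p : List D) : Set M.Edge := {e | e ∈ p.map M.edge}

/-- The vertices of a path other than its ends. -/
def pathInterior (p : List D) : Set M.Vertex := {v | v ∈ p.dropLast.map M.head}

/-- The vertex `v` is an end of the path `p`. -/
def IsEnd (p : List D) (v : M.Vertex) : Prop :=
  (∃ d ∈ p.head?, M.tail d = v) ∨ (∃ d ∈ p.getLast?, M.head d = v)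

/-- A set of pairwise edge-disjoint straight paths of interior edges, such that every end of a path
is on a hole or in the interior of another path of the set. -/
structure IsCutSet (S : Set (List D)) : Prop where
  isStraightPath : ∀ p ∈ S, M.IsStraightPath p
  disjoint : S.Pairwise (fun p q => Disjoint (M.pathEdges p) (M.pathEdges q))
  ends : ∀ p ∈ S, ∀ v, M.IsEnd p v → M.IsOnHole v ∨ ∃ q ∈ S, q ≠ p ∧ v ∈ M.pathInterior q

/-- The edges covered by the segments of a cut-set. -/
def cutEdges (S : Set (List D)) : Set M.Edge := {e | ∃ p ∈ S, e ∈ M.pathEdges p}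

/-! ### Saturation -/

/-- The `k` consecutive corners `d, next d, …` at the vertex `head d` form an angle induced by the
edges in `F`: the edge before the first corner and the edge after the last corner are in `F`, and
the edges in between are not.  (The edge before the corner `d` is `edge d`, the edge after it is
`edge (rot d)`.)  Such an angle sees `k` squares. -/
def IsAngle (F : Set M.Edge) (d : D) (k : ℕ) : Prop :=
  0 < k ∧ M.edge d ∈ F ∧
    (∀ i, i + 1 < k → M.edge (M.rot (M.next^[i] d)) ∉ F) ∧
    M.edge (M.rot (M.next^[k - 1] d)) ∈ F

/-- The set of edges `E₀` saturates the vertex `v`: either `v` is regular and not incident with an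
edge of `E₀`, or some edge of `E₀` or of the border is incident with `v`, and each angle that these
edges induce at `v` sees at most two squares. -/
def Saturates (E₀ : Set M.Edge) (v : M.Vertex) : Prop :=
  (M.IsRegular v ∧ ∀ e ∈ E₀, ¬ M.Incident e v) ∨
  ((∃ e ∈ E₀ ∪ M.border, M.Incident e v) ∧
    ∀ d k, M.head d = v → M.IsAngle (E₀ ∪ M.border) d k → k ≤ 2)

/-- Every vertex of the net is saturated by the edges of the cut-set. -/
def IsSaturating (S : Set (List D)) : Prop := ∀ v, M.Saturates (M.cutEdges S) v

/-! ### Rectangulations -/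

/-- A grid-shaped arrangement of distinct squares (a bundle of the strings): `cell i j` is the dart
that points to the right in the square in row `i` and column `j`.  The right side of each square is
the left side of the next one in its row, and the top side of each square is the bottom side of the
next one in its column. -/
structure Rectangle where
  rows : ℕ
  cols : ℕ
  rows_pos : 0 < rows
  cols_pos : 0 < cols
  cell : Fin rows → Fin cols → D
  distinct : ∀ i j i' j', M.square (cell i j) = M.square (cell i' j') → i = i' ∧ j = j'
  horizontal : ∀ (i : Fin rows) (j j' : Fin cols), j'.val = j.val + 1 →
    M.glue (cell i j) = M.rot (M.rot (cell i j'))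
  vertical : ∀ (i i' : Fin rows) (j : Fin cols), i'.val = i.val + 1 →
    M.glue (M.rot (cell i j)) = M.rot (M.rot (M.rot (cell i' j)))

variable {M} in
/-- The squares of a rectangle. -/
def Rectangle.squares (R : M.Rectangle) : Set M.Square := {s | ∃ i j, M.square (R.cell i j) = s}

variable {M} in
/-- The edges of the net along which grid-adjacent squares of a rectangle are joined. -/
def Rectangle.inner (R : M.Rectangle) : Set M.Edge :=
  {e | (∃ (i : Fin R.rows) (j j' : Fin R.cols), j'.val = j.val + 1 ∧ M.edge (R.cell i j) = e) ∨
    (∃ (i i' : Fin R.rows) (j : Fin R.cols), i'.val = i.val + 1 ∧ M.edge (M.rot (R.cell i j)) = e)}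

/-- A set of rectangles that partitions the squares of the net. -/
def IsRectangulation (Rs : Set M.Rectangle) : Prop := ∀ s : M.Square, ∃! R, R ∈ Rs ∧ s ∈ R.squares

/-- The interior edges of the net that do not join grid-adjacent squares of one of the rectangles. -/
def separating (Rs : Set M.Rectangle) : Set M.Edge :=
  {e | e ∉ M.border ∧ ∀ R ∈ Rs, e ∉ R.inner}

/-- The segments only include separating edges, and each separating edge is included in a
segment. -/
def Delimits (S : Set (List D)) (Rs : Set M.Rectangle) : Prop := M.cutEdges S = M.separating Rs

/-- A partition of the squares of the net into sets each of which can be arranged as a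
rectangle. -/
def IsRectanglePartition (P : Set (Set M.Square)) : Prop :=
  Setoid.IsPartition P ∧ ∀ A ∈ P, ∃ R : M.Rectangle, R.squares = A

/-- The edges of the net that belong to the boundary of two squares in different parts. -/
def separatingParts (P : Set (Set M.Square)) : Set M.Edge :=
  {e | ∃ d, M.edge d = e ∧ ∃ A ∈ P, ∃ B ∈ P, A ≠ B ∧ M.square d ∈ A ∧ M.square (M.glue d) ∈ B}

/-- The segments only include edges that separate different parts, and each such edge is included in
a segment. -/
def DelimitsParts (S : Set (List D)) (P : Set (Set M.Square)) : Prop :=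
  M.cutEdges S = M.separatingParts P

end CrossingMap

namespace CrossingMap

open Function

variable {D : Type*} (M : CrossingMap D)

/-! ### Darts, edges, squares and vertices -/

/-! Let `F` consist of the cut edges and the border. An angle that sees three or more squares
contains two consecutive free edges (edges not in `F`). So saturation everywhere says exactly that
two consecutive free edges occur only at a vertex of degree four all of whose edges are free. This
is `IsFlat` (`forall_saturates_iff_isFlat`), a condition on the permutation `next` alone.

Suppose `F` is flat. No string is closed, so walking along a string in either direction meets `F`.
Flatness lets one slide down a side in `F` to a corner, and makes each row above a corner a copy of
the row below until the whole top side lies in `F`. Hence every square lies in a grid with free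
inner edges and outer edges in `F` (`IsFlat.isTiled`). Such a grid is determined by any of its darts
(`IsGrid.unique`). A repeated square would therefore make the grid symmetric under a half turn,
which is impossible at the center (`IsGrid.not_symmetric`). So the grids are rectangles and
partition the squares.

Conversely, if every dart lies in such a grid, two consecutive free edges meet at a vertex inside a
grid, surrounded by four of its squares, so `F` is flat (`isFlat_of_isTiled`).

For the partition version, a rectangle could still touch itself along an outer edge. If strings
cross at most once, this would force a self-crossing or a closed string
(`IsPseudosegments.edge_mem_inner`), so separating edges are those between different parts. -/

theorem iterate_return {α : Type*} [Finite α] {f : α → α} (hf : Injective f) (x : α) (i : ℕ) :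
    ∃ j, f^[j] (f^[i] x) = x := by
  obtain ⟨p, hp, hx⟩ := hf.mem_periodicPts x
  refine ⟨i * p - i, ?_⟩
  rw [← iterate_add_apply, Nat.sub_add_cancel (Nat.le_mul_of_pos_right i hp)]
  exact hx.const_mul i

theorem glue_injective : Injective M.glue := (show Involutive M.glue from M.glue_glue).injective

theorem next_injective : Injective M.next := M.glue_injective.comp M.rot.injective

theorem rot_ne (d : D) : M.rot d ≠ d := fun h => M.rot_two_ne d (by rw [h, h])

theorem edge_glue (d : D) : M.edge (M.glue d) = M.edge d :=
  (Quot.sound (r := fun a b => b = M.glue a) rfl).symm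

theorem edge_next (d : D) : M.edge (M.next d) = M.edge (M.rot d) := M.edge_glue _

theorem edge_eq {a b : D} (h : M.edge a = M.edge b) : a = b ∨ a = M.glue b := by
  have := Quot.eqvGen_exact h
  clear h
  induction this with
  | rel x y h => right; rw [h, M.glue_glue]
  | refl x => exact .inl rfl
  | symm x y h ih =>
    rcases ih with rfl | rfl
    · exact .inl rfl
    · right; rw [M.glue_glue]
  | trans x y z h1 h2 ih1 ih2 =>
    rcases ih1 with rfl | rfl <;>
    rcases ih2 with rfl | rfl <;> simp [M.glue_glue]

theorem edge_mem_border {d : D} : M.edge d ∈ M.border ↔ M.glue d = d := by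
  refine ⟨?_, fun h => ⟨d, rfl, h⟩⟩
  rintro ⟨a, h, ha⟩
  rcases M.edge_eq h with rfl | rfl
  · exact ha
  · rw [M.glue_glue] at ha; exact ha.symm

theorem square_rot (d : D) : M.square (M.rot d) = M.square d :=
  (Quot.sound (r := fun a b => b = M.rot a) rfl).symm

theorem square_eq {a b : D} (h : M.square a = M.square b) :
    a = b ∨ a = M.rot b ∨ a = M.rot (M.rot b) ∨ a = M.rot (M.rot (M.rot b)) := by
  have := Quot.eqvGen_exact h
  clear h
  induction this with
  | rel x y h => subst h; simp [M.rot_four]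
  | refl x => exact .inl rfl
  | symm x y h ih =>
    rcases ih with rfl | rfl | rfl | rfl <;> simp [M.rot_four]
  | trans x y z h1 h2 ih1 ih2 =>
    rcases ih1 with rfl | rfl | rfl | rfl <;>
    rcases ih2 with rfl | rfl | rfl | rfl <;> simp [M.rot_four]

theorem head_next {d : D} (h : M.glue (M.rot d) ≠ M.rot d) : M.head (M.next d) = M.head d :=
  (Quot.sound ⟨h, rfl⟩).symm

theorem tail_rot (d : D) : M.tail (M.rot d) = M.head d := by simp [tail]

/-- The converse fails: past the end of a string, `next` moves on to another corner of the same face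
that may lie in a different cell. -/
theorem exists_iterate_of_head_eq [Finite D] {a b : D} (h : M.head a = M.head b) :
    ∃ i, M.next^[i] a = b := by
  have := Quot.eqvGen_exact h
  clear h
  induction this with
  | rel x y h => exact ⟨1, h.2.symm⟩
  | refl x => exact ⟨0, rfl⟩
  | symm x y h ih =>
    obtain ⟨i, rfl⟩ := ih
    exact iterate_return M.next_injective x i
  | trans x y z h1 h2 ih1 ih2 =>
    obtain ⟨i, rfl⟩ := ih1
    obtain ⟨j, rfl⟩ := ih2
    exact ⟨j + i, iterate_add_apply _ _ _ _⟩

theorem incident_edge (d : D) : M.Incident (M.edge d) (M.head d) := ⟨d, rfl, .inr rfl⟩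

theorem incident_edge_rot (d : D) : M.Incident (M.edge (M.rot d)) (M.head d) :=
  ⟨M.rot d, rfl, .inl (M.tail_rot d)⟩

theorem Incident.exists_head {e : M.Edge} {v : M.Vertex} (h : M.Incident e v) :
    ∃ a, M.head a = v ∧ (M.edge a = e ∨ M.edge (M.next a) = e) := by
  obtain ⟨d, rfl, h | h⟩ := h
  · exact ⟨_, h, .inr (by simp [edge_next])⟩
  · exact ⟨d, h, .inl rfl⟩

theorem head_iterate_of_interior {d : D} (hb : ¬ M.IsBorderVertex (M.head d)) (i : ℕ) :
    M.head (M.next^[i] d) = M.head d := by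
  induction i with
  | zero => rfl
  | succ i ih =>
    rw [iterate_succ_apply', head_next, ih]
    intro h
    exact hb ⟨_, M.edge_mem_border.2 h, ih ▸ M.incident_edge_rot _⟩

/-- The corners at an interior vertex form a whole cycle of `next`, and `rot` matches them with the
darts that leave the vertex. -/
theorem degree_eq_minimalPeriod [Finite D] {d : D} (hb : ¬ M.IsBorderVertex (M.head d)) :
    M.degree (M.head d) = minimalPeriod M.next d := by
  have h1 : {a | M.glue a = a ∧ M.head a = M.head d} = ∅ := by
    refine Set.eq_empty_of_forall_notMem fun a ha => hb ?_
    exact ⟨_, M.edge_mem_border.2 ha.1, ha.2 ▸ M.incident_edge a⟩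
  have h2 : {a | M.tail a = M.head d} =
      M.rot '' ((fun i => M.next^[i] d) '' Set.Iio (minimalPeriod M.next d)) := by
    ext a
    constructor
    · intro ha
      obtain ⟨i, hi⟩ := M.exists_iterate_of_head_eq (a := d) (b := M.rot.symm a) ha.symm
      refine ⟨M.rot.symm a, ⟨i % minimalPeriod M.next d, ?_, ?_⟩, by simp⟩
      · exact Nat.mod_lt _ (minimalPeriod_pos_of_mem_periodicPts
          (M.next_injective.mem_periodicPts d))
      · simp only [iterate_mod_minimalPeriod_eq, hi]
    · rintro ⟨_, ⟨i, -, rfl⟩, rfl⟩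
      simp only [Set.mem_ofPred_eq, tail_rot, M.head_iterate_of_interior hb]
  rw [degree, h1, h2, Set.ncard_image_of_injective _ M.rot.injective,
    iterate_injOn_Iio_minimalPeriod.ncard_image, Set.ncard_empty]
  simp

/-! ### Saturation and flatness -/

/-- Two rotationally consecutive edges at a vertex that are both not in `F` occur only at regular
vertices all of whose edges are not in `F`. -/
def IsFlat (F : Set M.Edge) : Prop :=
  ∀ d, M.edge d ∉ F → M.edge (M.next d) ∉ F →
    M.next^[4] d = d ∧ M.next^[2] d ≠ d ∧ ∀ i, M.edge (M.next^[i] d) ∉ F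

theorem minimalPeriod_eq_four {α : Type*} {f : α → α} {x : α} :
    minimalPeriod f x = 4 ↔ f^[4] x = x ∧ f^[2] x ≠ x := by
  constructor
  · intro h
    refine ⟨h ▸ iterate_minimalPeriod, fun h2 => ?_⟩
    have := IsPeriodicPt.minimalPeriod_dvd (n := 2) h2
    rw [h] at this
    omega
  · rintro ⟨h4, h2⟩
    have hd := IsPeriodicPt.minimalPeriod_dvd (n := 4) h4
    have hle := Nat.le_of_dvd (by norm_num) hd
    have h2' : ¬ minimalPeriod f x ∣ 2 := fun h => h2 ((isPeriodicPt_iff_minimalPeriod_dvd).2 h)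
    generalize minimalPeriod f x = k at *
    interval_cases k <;> omega

/-- Go back from `d` to the nearest edge of `F`, then forward to the next one. No border edge is
passed on the way back, so the vertex does not change, and the angle contains the free edges of `d`
and `next d`. -/
theorem exists_isAngle [Finite D] {F : Set M.Edge} (hF : M.border ⊆ F) {d : D}
    (h0 : M.edge d ∉ F) (h1 : M.edge (M.next d) ∉ F)
    (h : ∃ e ∈ F, M.Incident e (M.head d)) :
    ∃ a k, M.head a = M.head d ∧ M.IsAngle F a k ∧ 2 < k := by
  classical
  have hex : ∃ j a, M.next^[j] a = d ∧ M.edge a ∈ F := by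
    obtain ⟨e, he, hi⟩ := h
    obtain ⟨b, hb, hbe⟩ := hi.exists_head
    obtain ⟨i, rfl⟩ := M.exists_iterate_of_head_eq hb.symm
    obtain ⟨i, hi⟩ : ∃ i, M.edge (M.next^[i] d) ∈ F := by
      rcases hbe with rfl | rfl
      · exact ⟨i, he⟩
      · exact ⟨i + 1, by rwa [iterate_succ_apply']⟩
    obtain ⟨j, hj⟩ := iterate_return M.next_injective d i
    exact ⟨j, _, hj, hi⟩
  obtain ⟨a, had, ha⟩ := Nat.find_spec hex
  set j := Nat.find hex with hj
  have hfree : ∀ i, 0 < i → i ≤ j → M.edge (M.next^[i] a) ∉ F := by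
    intro i hi hij hm
    refine Nat.find_min hex (m := j - i) (by omega) ⟨_, ?_, hm⟩
    rw [← iterate_add_apply, Nat.sub_add_cancel hij, had]
  have hjpos : 0 < j := by
    rcases Nat.eq_zero_or_pos j with h | h
    · rw [h] at had
      exact absurd (had ▸ ha) h0
    · exact h
  have hk : ∃ k, 0 < k ∧ M.edge (M.next^[k] a) ∈ F := by
    obtain ⟨p, hp, hx⟩ := M.next_injective.mem_periodicPts a
    exact ⟨p, hp, by rwa [hx]⟩
  obtain ⟨hk0, hkF⟩ := Nat.find_spec hk
  have hmin := fun m => Nat.find_min hk (m := m)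
  set k := Nat.find hk
  refine ⟨a, k, ?_, ⟨hk0, ha, ?_, ?_⟩, ?_⟩
  · have : ∀ i ≤ j, M.head (M.next^[i] a) = M.head a := by
      intro i
      induction i with
      | zero => intro _; rfl
      | succ i ih =>
        intro hi
        have h' := hfree (i + 1) (by omega) hi
        rw [iterate_succ_apply', edge_next] at h'
        rw [iterate_succ_apply', head_next, ih (by omega)]
        exact fun hb => h' (hF (M.edge_mem_border.2 hb))
    rw [← this j le_rfl, had]
  · intro i hi
    rw [← edge_next, ← iterate_succ_apply' (f := M.next)]
    exact fun hm => hmin _ hi ⟨Nat.succ_pos i, hm⟩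
  · rw [← edge_next, ← iterate_succ_apply' (f := M.next), Nat.sub_one, Nat.succ_pred hk0.ne']
    exact hkF
  · by_contra! hk2
    -- Here `0 < j`, so `k ≤ 2` leaves only these cases; position `j` is `d` and position `j + 1` is
    -- `next d`.
    rcases (by omega : k ≤ j ∨ k = j + 1) with hkj | hkj
    · exact hfree k hk0 hkj hkF
    · rw [hkj, iterate_succ_apply', had] at hkF
      exact h1 hkF

/-- A wide angle has free edges at its second and third positions; flatness would then free the
whole `next`-cycle, including the closing edge of the angle. -/
theorem forall_saturates_iff_isFlat [Finite D] (E₀ : Set M.Edge) :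
    (∀ v, M.Saturates E₀ v) ↔ M.IsFlat (E₀ ∪ M.border) := by
  constructor
  · intro hs d h0 h1
    rcases hs (M.head d) with ⟨⟨hb, hdeg⟩, hE⟩ | ⟨hex, hang⟩
    · rw [M.degree_eq_minimalPeriod hb, minimalPeriod_eq_four] at hdeg
      refine ⟨hdeg.1, hdeg.2, fun i => ?_⟩
      have hinc : M.Incident (M.edge (M.next^[i] d)) (M.head d) :=
        M.head_iterate_of_interior hb i ▸ M.incident_edge _
      rintro (h | h)
      · exact hE _ h hinc
      · exact hb ⟨_, h, hinc⟩
    · obtain ⟨a, k, ha, hak, hk⟩ := M.exists_isAngle Set.subset_union_right h0 h1 hex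
      exact absurd (hang a k ha hak) (by omega)
  · intro hf v
    obtain ⟨d, rfl⟩ := Quot.exists_rep v
    change M.Saturates E₀ (M.head d)
    by_cases hex : ∃ e ∈ E₀ ∪ M.border, M.Incident e (M.head d)
    · refine .inr ⟨hex, ?_⟩
      rintro a k - ⟨hk0, ha, hfree, hk⟩
      by_contra! hk2
      have h1 := hfree 0 (by omega)
      have h2 := hfree 1 (by omega)
      rw [← edge_next] at h1 h2
      have := (hf (M.next a) h1 h2).2.2 (k - 1)
      rw [← iterate_succ_apply, iterate_succ_apply', edge_next] at this
      exact this hk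
    · push Not at hex
      have hb : ¬ M.IsBorderVertex (M.head d) := fun ⟨e, he, hi⟩ => hex e (.inr he) hi
      have h0 : M.edge d ∉ E₀ ∪ M.border := fun h => hex _ h (M.incident_edge d)
      have h1 : M.edge (M.next d) ∉ E₀ ∪ M.border := fun h =>
        hex _ h (M.edge_next d ▸ M.incident_edge_rot d)
      obtain ⟨h4, h2, -⟩ := hf d h0 h1
      refine .inl ⟨⟨hb, ?_⟩, fun e he => hex e (.inl he)⟩
      rw [M.degree_eq_minimalPeriod hb, minimalPeriod_eq_four]
      exact ⟨h4, h2⟩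

/-! ### Grids -/

/-- The dart in which a string leaves the crossing that it reaches along the dart `d`. -/
def ahead (d : D) : D := M.rot (M.rot (M.glue d))

/-- The dart parallel to `d` at the crossing reached along `rot d`. -/
def above (d : D) : D := M.rot (M.glue (M.rot d))

theorem ahead_injective : Injective M.ahead :=
  M.rot.injective.comp (M.rot.injective.comp M.glue_injective)

/-- The values of `g` at pairs `i < n` and `j < m` are the darts to the right in an `n × m` grid of
squares, whose inner edges are not in `F` and whose outer edges are in `F`. -/
structure IsGrid (F : Set M.Edge) (n m : ℕ) (g : ℕ → ℕ → D) : Prop where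
  right : ∀ i j, i < n → j + 1 < m → M.glue (g i j) = M.rot (M.rot (g i (j + 1)))
  up : ∀ i j, i + 1 < n → j < m → M.glue (M.rot (g i j)) = M.rot (M.rot (M.rot (g (i + 1) j)))
  right_inner : ∀ i j, i < n → j + 1 < m → M.edge (g i j) ∉ F
  up_inner : ∀ i j, i + 1 < n → j < m → M.edge (M.rot (g i j)) ∉ F
  right_outer : ∀ i j, i < n → j + 1 = m → M.edge (g i j) ∈ F
  up_outer : ∀ i j, i + 1 = n → j < m → M.edge (M.rot (g i j)) ∈ F
  left_outer : ∀ i, i < n → 0 < m → M.edge (M.rot (M.rot (g i 0))) ∈ F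
  down_outer : ∀ j, 0 < n → j < m → M.edge (M.rot (M.rot (M.rot (g 0 j)))) ∈ F

/-- The grid positions have distinct squares. -/
def SquaresDistinct (n m : ℕ) (g : ℕ → ℕ → D) : Prop :=
  ∀ i j i' j', i < n → j < m → i' < n → j' < m →
    M.square (g i j) = M.square (g i' j') → i = i' ∧ j = j'

/-- The grid turned clockwise by a right angle. -/
def turn (m : ℕ) (g : ℕ → ℕ → D) (i j : ℕ) : D := M.rot (g j (m - 1 - i))

variable {M} {F : Set M.Edge} {n m n' m' : ℕ} {g g' : ℕ → ℕ → D}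

/-- A quarter turn permutes the eight clauses, so facts about rows carry over to columns. -/
theorem IsGrid.turn (h : M.IsGrid F n m g) : M.IsGrid F m n (M.turn m g) where
  right i j hi hj := by rw [CrossingMap.turn, h.up _ _ hj (by omega)]; rfl
  up i j hi hj := by
    have := h.right j (m - 1 - (i + 1)) hj (by omega)
    rw [show m - 1 - (i + 1) + 1 = m - 1 - i by omega] at this
    simp only [CrossingMap.turn, M.rot_four]
    rw [← this, M.glue_glue]
  right_inner i j hi hj := h.up_inner _ _ hj (by omega)
  up_inner i j hi hj := by
    have := h.right j (m - 1 - (i + 1)) hj (by omega)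
    rw [show m - 1 - (i + 1) + 1 = m - 1 - i by omega] at this
    rw [CrossingMap.turn, ← this, M.edge_glue]
    exact h.right_inner _ _ hj (by omega)
  right_outer i j hi hj := h.up_outer _ _ hj (by omega)
  up_outer i j hi hj := by
    rw [CrossingMap.turn, show m - 1 - i = 0 by omega]
    exact h.left_outer _ hj (by omega)
  left_outer i hi hn := h.down_outer _ hn (by omega)
  down_outer j hm hj := by
    rw [CrossingMap.turn, M.rot_four]
    exact h.right_outer _ _ hj (by omega)

theorem turn_of_lt (M : CrossingMap D) (g : ℕ → ℕ → D) (i : ℕ) {j : ℕ} (hj : j < m) :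
    M.turn m g (m - 1 - j) i = M.rot (g i j) := by
  rw [CrossingMap.turn, show m - 1 - (m - 1 - j) = j by omega]

theorem SquaresDistinct.turn (h : M.SquaresDistinct n m g) :
    M.SquaresDistinct m n (M.turn m g) := by
  intro i j i' j' hi hj hi' hj' he
  simp only [CrossingMap.turn, square_rot] at he
  have := h _ _ _ _ hj (by omega) hj' (by omega) he
  omega

theorem IsGrid.right_iff (h : M.IsGrid F n m g) {i j : ℕ} (hi : i < n) (hj : j < m) :
    M.edge (g i j) ∉ F ↔ j + 1 < m := by
  refine ⟨fun hf => ?_, h.right_inner _ _ hi⟩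
  by_contra hm
  exact hf (h.right_outer _ _ hi (by omega))

theorem IsGrid.up_iff (h : M.IsGrid F n m g) {i j : ℕ} (hi : i < n) (hj : j < m) :
    M.edge (M.rot (g i j)) ∉ F ↔ i + 1 < n := by
  refine ⟨fun hf => ?_, fun hi => h.up_inner _ _ hi hj⟩
  by_contra hm
  exact hf (h.up_outer _ _ (by omega) hj)

theorem IsGrid.left_iff (h : M.IsGrid F n m g) {i j : ℕ} (hi : i < n) (hj : j < m) :
    M.edge (M.rot (M.rot (g i j))) ∉ F ↔ 0 < j := by
  rcases j with _ | j
  · simpa using h.left_outer _ hi hj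
  · rw [← h.right _ _ hi hj, edge_glue]
    simpa using h.right_inner _ _ hi hj

theorem IsGrid.down_iff (h : M.IsGrid F n m g) {i j : ℕ} (hi : i < n) (hj : j < m) :
    M.edge (M.rot (M.rot (M.rot (g i j)))) ∉ F ↔ 0 < i := by
  rcases i with _ | i
  · simpa using h.down_outer _ hi hj
  · rw [← h.up _ _ hi hj, edge_glue]
    simpa using h.up_inner _ _ hi hj

/-- Whether a row continues depends only on whether the edge ahead is in `F`, so two grids sharing a
dart extend in step. -/
theorem IsGrid.row_right (h : M.IsGrid F n m g) (h' : M.IsGrid F n' m' g') {i j i' j' : ℕ}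
    (hi : i < n) (hi' : i' < n') (hj' : j' < m') (he : g i j = g' i' j') (k : ℕ)
    (hk : j + k < m) : j' + k < m' ∧ g i (j + k) = g' i' (j' + k) := by
  induction k with
  | zero => exact ⟨hj', he⟩
  | succ k ih =>
    obtain ⟨hk', ih⟩ := ih (by omega)
    have hf := (h.right_iff hi (by omega)).2 (show j + k + 1 < m by omega)
    rw [ih] at hf
    have hm := (h'.right_iff hi' hk').1 hf
    refine ⟨hm, M.rot.injective (M.rot.injective ?_)⟩
    rw [← add_assoc, ← add_assoc, ← h.right _ _ hi (by omega), ← h'.right _ _ hi' hm, ih]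

theorem IsGrid.row_left (h : M.IsGrid F n m g) (h' : M.IsGrid F n' m' g') {i j i' j' : ℕ}
    (hi : i < n) (hj : j < m) (hi' : i' < n') (hj' : j' < m') (he : g i j = g' i' j') (k : ℕ)
    (hk : k ≤ j) : k ≤ j' ∧ g i (j - k) = g' i' (j' - k) := by
  induction k with
  | zero => exact ⟨Nat.zero_le _, he⟩
  | succ k ih =>
    obtain ⟨hk', ih⟩ := ih (by omega)
    have hf := (h.left_iff hi (j := j - k) (by omega)).2 (by omega)
    rw [ih] at hf
    have hm := (h'.left_iff hi' (j := j' - k) (by omega)).1 hf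
    refine ⟨by omega, M.glue_injective ?_⟩
    rw [h.right _ _ hi (by omega), h'.right _ _ hi' (by omega),
      show j - (k + 1) + 1 = j - k by omega, show j' - (k + 1) + 1 = j' - k by omega, ih]

theorem IsGrid.row_unique (h : M.IsGrid F n m g) (h' : M.IsGrid F n' m' g') {i j i' j' : ℕ}
    (hi : i < n) (hj : j < m) (hi' : i' < n') (hj' : j' < m') (he : g i j = g' i' j') :
    m = m' ∧ j = j' ∧ ∀ b < m, g i b = g' i' b := by
  have l := (h.row_left h' hi hj hi' hj' he j le_rfl).1
  have l' := (h'.row_left h hi' hj' hi hj he.symm j' le_rfl).1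
  obtain rfl : j = j' := by omega
  have r := (h.row_right h' hi hi' hj' he (m - 1 - j) (by omega)).1
  have r' := (h'.row_right h hi' hi hj he.symm (m' - 1 - j) (by omega)).1
  refine ⟨by omega, rfl, fun b hb => ?_⟩
  rcases le_total j b with hjb | hjb
  · have := (h.row_right h' hi hi' hj' he (b - j) (by omega)).2
    rwa [show j + (b - j) = b by omega] at this
  · have := (h.row_left h' hi hj hi' hj' he (j - b) (by omega)).2
    rwa [show j - (j - b) = b by omega] at this

theorem IsGrid.unique (h : M.IsGrid F n m g) (h' : M.IsGrid F n' m' g') {i j i' j' : ℕ}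
    (hi : i < n) (hj : j < m) (hi' : i' < n') (hj' : j' < m') (he : g i j = g' i' j') :
    n = n' ∧ m = m' ∧ i = i' ∧ j = j' ∧ ∀ a < n, ∀ b < m, g a b = g' a b := by
  obtain ⟨rfl, rfl, -⟩ := h.row_unique h' hi hj hi' hj' he
  obtain ⟨rfl, rfl, hc⟩ := h.turn.row_unique h'.turn (i := m - 1 - j) (j := i) (i' := m - 1 - j)
    (j' := i') (by omega) hi (by omega) hi' (by rw [turn_of_lt M _ _ hj, turn_of_lt M _ _ hj, he])
  refine ⟨rfl, rfl, rfl, rfl, fun a ha => ?_⟩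
  refine (h.row_unique h' ha hj ha hj (M.rot.injective ?_)).2.2
  rw [← turn_of_lt M g a hj, ← turn_of_lt M g' a hj]
  exact hc a ha

/-- A grid in a flat surface is not symmetric with respect to its center. -/
theorem IsGrid.not_symmetric (h : M.IsGrid F n m g) (hf : M.IsFlat F) (hF : M.border ⊆ F)
    (hn : 0 < n) (hm : 0 < m)
    (hs : ∀ a < n, ∀ b < m, g a b = M.rot (M.rot (g (n - 1 - a) (m - 1 - b)))) : False := by
  -- The parities decide whether the center is a vertex, an edge or a square. A half turn about it
  -- would make `next^[2]` fix a corner, make an inner edge a border edge, or make `rot` have order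
  -- two.
  obtain ⟨p, hp⟩ := Nat.even_or_odd' n
  obtain ⟨q, hq⟩ := Nat.even_or_odd' m
  rcases hp with hp | hp <;> rcases hq with hq | hq
  · have hs := hs (p - 1) (by omega) (q - 1) (by omega)
    obtain ⟨p, rfl⟩ : ∃ p', p = p' + 1 := ⟨p - 1, by omega⟩
    obtain ⟨q, rfl⟩ : ∃ q', q = q' + 1 := ⟨q - 1, by omega⟩
    rw [show n - 1 - (p + 1 - 1) = p + 1 by omega, show m - 1 - (q + 1 - 1) = q + 1 by omega] at hs
    simp only [Nat.add_sub_cancel] at hs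
    refine (hf (g p q) (h.right_inner _ _ (by omega) (by omega)) ?_).2.1 ?_
    · rw [edge_next]
      exact h.up_inner _ _ (by omega) (by omega)
    · simp only [iterate_succ, iterate_zero, comp_apply, id, next]
      rw [h.up _ _ (by omega) (by omega), M.rot_four, h.right _ _ (by omega) (by omega), hs]
  · have hs := hs (p - 1) (by omega) q (by omega)
    obtain ⟨p, rfl⟩ : ∃ p', p = p' + 1 := ⟨p - 1, by omega⟩
    rw [show n - 1 - (p + 1 - 1) = p + 1 by omega, show m - 1 - q = q by omega] at hs
    simp only [Nat.add_sub_cancel] at hs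
    refine h.up_inner p q (by omega) (by omega) (hF (M.edge_mem_border.2 ?_))
    rw [h.up _ _ (by omega) (by omega), hs]
  · have hs := hs p (by omega) (q - 1) (by omega)
    obtain ⟨q, rfl⟩ : ∃ q', q = q' + 1 := ⟨q - 1, by omega⟩
    rw [show n - 1 - p = p by omega, show m - 1 - (q + 1 - 1) = q + 1 by omega] at hs
    simp only [Nat.add_sub_cancel] at hs
    refine h.right_inner p q (by omega) (by omega) (hF (M.edge_mem_border.2 ?_))
    rw [h.right _ _ (by omega) (by omega), hs]
  · have hs := hs p (by omega) q (by omega)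
    rw [show n - 1 - p = p by omega, show m - 1 - q = q by omega] at hs
    exact M.rot_two_ne _ hs.symm

/-- Two positions with the same square carry darts that differ by a rotation, so by uniqueness the
grid coincides with a turned copy of itself. -/
theorem IsGrid.squaresDistinct (h : M.IsGrid F n m g) (hf : M.IsFlat F) (hF : M.border ⊆ F) :
    M.SquaresDistinct n m g := by
  have quarter : ∀ i j i' j', i < n → j < m → i' < n → j' < m → g i j ≠ M.rot (g i' j') := by
    intro i j i' j' hi hj hi' hj' he
    rw [← turn_of_lt M g i' hj'] at he
    obtain ⟨rfl, -, -, -, hc⟩ := h.unique h.turn hi hj (by omega) hi' he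
    -- A quarter-turn symmetry applied twice is a half-turn symmetry.
    refine h.not_symmetric hf hF (by omega) (by omega) fun a ha b hb => ?_
    rw [hc a ha b hb, CrossingMap.turn, hc b hb _ (by omega), CrossingMap.turn]
  have half : ∀ i j i' j', i < n → j < m → i' < n → j' < m →
      g i j ≠ M.rot (M.rot (g i' j')) := by
    intro i j i' j' hi hj hi' hj' he
    rw [← turn_of_lt M g i' hj', ← turn_of_lt M _ _ hi'] at he
    obtain ⟨-, -, -, -, hc⟩ := h.unique h.turn.turn hi hj (by omega) (by omega) he
    exact h.not_symmetric hf hF (by omega) (by omega) fun a ha b hb => hc a ha b hb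
  intro i j i' j' hi hj hi' hj' he
  rcases M.square_eq he with he | he | he | he
  · have := h.unique h hi hj hi' hj' he
    omega
  · exact absurd he (quarter _ _ _ _ hi hj hi' hj')
  · exact absurd he (half _ _ _ _ hi hj hi' hj')
  · refine absurd ?_ (quarter _ _ _ _ hi' hj' hi hj)
    rw [he, M.rot_four]

variable (M) in
/-- The squares of an `n × m` grid. -/
def gridSquares (n m : ℕ) (g : ℕ → ℕ → D) : Set M.Square :=
  {s | ∃ i < n, ∃ j < m, M.square (g i j) = s}

theorem gridSquares_turn : M.gridSquares m n (M.turn m g) = M.gridSquares n m g := by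
  ext s
  constructor
  · rintro ⟨i, hi, j, hj, rfl⟩
    exact ⟨j, hj, m - 1 - i, by omega, (M.square_rot _).symm⟩
  · rintro ⟨i, hi, j, hj, rfl⟩
    exact ⟨m - 1 - j, by omega, i, hi, by rw [turn_of_lt M g i hj, square_rot]⟩

variable (M) in
/-- The dart `d` points to the right in a square of a grid with the set `A` of squares, which are
distinct. -/
def IsTiledBy (F : Set M.Edge) (A : Set M.Square) (d : D) : Prop :=
  ∃ n m g, M.IsGrid F n m g ∧ M.SquaresDistinct n m g ∧ M.gridSquares n m g = A ∧
    ∃ i < n, ∃ j < m, g i j = d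

variable (M) in
/-- The dart `d` points to the right in a square of a grid of distinct squares. -/
def IsTiled (F : Set M.Edge) (d : D) : Prop := ∃ A, M.IsTiledBy F A d

theorem IsTiledBy.rot {A : Set M.Square} {d : D} (h : M.IsTiledBy F A d) :
    M.IsTiledBy F A (M.rot d) := by
  obtain ⟨n, m, g, hg, hd, rfl, i, hi, j, hj, rfl⟩ := h
  exact ⟨m, n, _, hg.turn, hd.turn, gridSquares_turn, m - 1 - j, by omega, i, hi,
    turn_of_lt M g i hj⟩

theorem IsTiledBy.of_square_eq {A : Set M.Square} {d d' : D} (h : M.IsTiledBy F A d)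
    (he : M.square d' = M.square d) : M.IsTiledBy F A d' := by
  rcases M.square_eq he with rfl | rfl | rfl | rfl
  exacts [h, h.rot, h.rot.rot, h.rot.rot.rot]

theorem IsTiledBy.square_mem {A : Set M.Square} {d : D} (h : M.IsTiledBy F A d) :
    M.square d ∈ A := by
  obtain ⟨n, m, g, -, -, rfl, i, hi, j, hj, rfl⟩ := h
  exact ⟨i, hi, j, hj, rfl⟩

theorem IsTiledBy.unique {A A' : Set M.Square} {d : D} (h : M.IsTiledBy F A d)
    (h' : M.IsTiledBy F A' d) : A = A' := by
  obtain ⟨n, m, g, hg, -, rfl, i, hi, j, hj, rfl⟩ := h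
  obtain ⟨n', m', g', hg', -, rfl, i', hi', j', hj', he⟩ := h'
  obtain ⟨rfl, rfl, -, -, hc⟩ := hg.unique hg' hi hj hi' hj' he.symm
  ext s
  constructor <;> rintro ⟨a, ha, b, hb, rfl⟩ <;> exact ⟨a, ha, b, hb, by rw [hc a ha b hb]⟩

theorem IsTiled.rot {d : D} (h : M.IsTiled F d) : M.IsTiled F (M.rot d) :=
  h.imp fun _ => IsTiledBy.rot

theorem IsTiled.glue {d : D} (h : M.IsTiled F d) (hd : M.edge d ∉ F) :
    M.IsTiled F (M.glue d) := by
  obtain ⟨A, n, m, g, hg, hs, hA, i, hi, j, hj, rfl⟩ := h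
  have hm := (hg.right_iff hi hj).1 hd
  rw [hg.right _ _ hi hm]
  exact (IsTiled.rot ⟨A, n, m, g, hg, hs, hA, i, hi, j + 1, hm, rfl⟩).rot

/-- Free right and upper sides of a cell mean that the grid continues both ways, so the corner lies
inside the grid and its `next`-cycle runs through four distinct squares. -/
theorem isFlat_of_isTiled (h : ∀ d, M.IsTiled F d) : M.IsFlat F := by
  intro d h0 h1
  obtain ⟨-, n, m, g, hg, hs, -, i, hi, j, hj, rfl⟩ := h d
  rw [edge_next] at h1
  have hm := (hg.right_iff hi hj).1 h0
  have hn := (hg.up_iff hi hj).1 h1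
  have e1 : M.next (g i j) = M.rot (M.rot (M.rot (g (i + 1) j))) := hg.up _ _ hn hj
  have e2 : M.next (M.rot (M.rot (M.rot (g (i + 1) j)))) = M.rot (M.rot (g (i + 1) (j + 1))) := by
    rw [next, M.rot_four, hg.right _ _ hn hm]
  have e3 : M.next (M.rot (M.rot (g (i + 1) (j + 1)))) = M.rot (g i (j + 1)) := by
    rw [next, ← hg.up _ _ hn hm, M.glue_glue]
  have e4 : M.next (M.rot (g i (j + 1))) = g i j := by
    rw [next, ← hg.right _ _ hi hm, M.glue_glue]
  have h4 : M.next^[4] (g i j) = g i j := by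
    simp only [iterate_succ, iterate_zero, comp_apply, id, e1, e2, e3, e4]
  refine ⟨h4, ?_, fun k => ?_⟩
  · simp only [iterate_succ, iterate_zero, comp_apply, id, e1, e2]
    intro he
    have := congrArg M.square he
    rw [square_rot, square_rot] at this
    have := hs _ _ _ _ hn hm hi hj this
    omega
  · rw [← IsPeriodicPt.iterate_mod_apply (n := 4) h4]
    have := Nat.mod_lt k (show 0 < 4 by norm_num)
    generalize k % 4 = k at *
    interval_cases k <;> simp only [iterate_succ, iterate_zero, comp_apply, id, e1, e2, e3]
    · exact h0
    · exact (hg.down_iff hn hj).2 (by omega)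
    · exact (hg.left_iff hn hm).2 (by omega)
    · exact (hg.up_iff hi hm).2 hn

/-! ### Construction of grids -/

theorem next_rot_ahead (d : D) : M.next (M.rot (M.ahead d)) = d := by
  simp [next, ahead, M.rot_four, M.glue_glue]

/-- At the vertex `head d`, the edge of `d` lies between the two edges compared; if it is free,
flatness makes both of them free or neither. -/
theorem IsFlat.rot_ahead_iff (hf : M.IsFlat F) {d : D} (hd : M.edge d ∉ F) :
    M.edge (M.rot (M.ahead d)) ∉ F ↔ M.edge (M.rot d) ∉ F := by
  constructor
  · intro h
    have := (hf _ h (by rwa [next_rot_ahead])).2.2 2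
    rwa [iterate_succ_apply, next_rot_ahead, iterate_one, edge_next] at this
  · intro h
    obtain ⟨h4, -, hi⟩ := hf d hd (by rwa [edge_next])
    have : M.rot (M.ahead d) = M.next^[3] d := by
      apply M.next_injective
      rw [next_rot_ahead, ← iterate_succ_apply' (f := M.next), h4]
    rw [this]
    exact hi 3

theorem IsFlat.above_ahead (hf : M.IsFlat F) {d : D} (hd : M.edge d ∉ F)
    (hr : M.edge (M.rot d) ∉ F) :
    M.edge (M.above d) ∉ F ∧ M.glue (M.above d) = M.rot (M.rot (M.above (M.ahead d))) := by
  obtain ⟨h4, -, hi⟩ := hf d hd (by rwa [edge_next])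
  have h2 : M.next^[2] d = M.glue (M.above d) := rfl
  refine ⟨by simpa [h2, edge_glue] using hi 2, ?_⟩
  have h3 : M.next (M.glue (M.above d)) = M.rot (M.ahead d) := by
    apply M.next_injective
    rw [next_rot_ahead, ← h2, ← iterate_succ_apply' (f := M.next),
      ← iterate_succ_apply' (f := M.next), h4]
  rw [show M.above (M.ahead d) = M.rot (M.glue (M.rot (M.ahead d))) from rfl, ← h3, next,
    M.glue_glue, M.rot_four]

/-- This propagates the right side of a grid upwards: if the edges of `rot d` and `above d` were
both free, flatness at `head d` would free the edge of `d` too. -/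
theorem IsFlat.above_mem (hf : M.IsFlat F) {d : D} (hd : M.edge d ∈ F)
    (hr : M.edge (M.rot d) ∉ F) : M.edge (M.above d) ∈ F := by
  by_contra h
  obtain ⟨h4, -, hi⟩ := hf (M.next d) (by rwa [edge_next]) (by rwa [edge_next])
  have := hi 3
  rw [iterate_succ_apply' (f := M.next), ← iterate_succ_apply' (f := M.next),
    ← iterate_succ_apply (f := M.next)] at this
  rw [← iterate_succ_apply, iterate_succ_apply'] at h4
  rw [M.next_injective h4] at this
  exact this hd

theorem IsFlat.left_above_mem (hf : M.IsFlat F) {d : D} (hd : M.edge (M.rot (M.rot d)) ∈ F)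
    (hr : M.edge (M.rot d) ∉ F) : M.edge (M.rot (M.rot (M.above d))) ∈ F := by
  by_contra h
  have e : M.next (M.rot (M.rot (M.above d))) = M.rot d := by
    simp [next, above, M.rot_four, M.glue_glue]
  have := (hf _ h (by rwa [e])).2.2 2
  rw [iterate_succ_apply, e, iterate_one, edge_next] at this
  exact this hd

theorem SameString.induction {p : D → Prop} (hglue : ∀ x, p x → p (M.glue x))
    (hrot : ∀ x, p x → p (M.rot (M.rot x))) {a b : D} (h : M.SameString a b) (ha : p a) : p b := by
  suffices p a ↔ p b from this.1 ha
  clear ha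
  induction h with
  | rel x y h =>
    rcases h with rfl | rfl
    · exact ⟨hglue x, fun h => by simpa [M.glue_glue] using hglue _ h⟩
    · exact ⟨hrot x, fun h => by simpa [M.rot_four] using hrot _ h⟩
  | refl x => rfl
  | symm x y _ ih => exact ih.symm
  | trans x y z _ _ ih1 ih2 => exact ih1.trans ih2

theorem glue_ahead (d : D) : M.glue d = M.rot (M.rot (M.ahead d)) := by rw [ahead, M.rot_four]

/-- At an end of a string `ahead` just reverses the dart. The `ahead`-orbit with its reversed darts
is closed under both generators of `SameString`, so it contains a dart at an end of the string. -/
theorem exists_ahead_iterate_mem [Finite D] (hM : M.IsStringSet) (hF : M.border ⊆ F) (d : D) :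
    ∃ k, M.edge (M.ahead^[k] d) ∈ F := by
  obtain ⟨d', hs, hd'⟩ := hM.not_closed d
  -- Going backwards reaches the predecessor under `ahead`, which by finiteness is also a forward
  -- iterate.
  have hback : ∀ k, ∃ j, M.glue (M.rot (M.rot (M.ahead^[k] d))) = M.ahead^[j] d := by
    intro k
    obtain ⟨j, hj⟩ := iterate_return M.ahead_injective (M.ahead^[k] d) 1
    refine ⟨j + k, M.glue_injective ?_⟩
    rw [M.glue_glue, iterate_add_apply, glue_ahead, ← iterate_succ_apply' (f := M.ahead),
      iterate_succ_apply]
    exact congrArg (fun x => M.rot (M.rot x)) hj.symm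
  have hr : ∃ k, d' = M.ahead^[k] d ∨ d' = M.rot (M.rot (M.ahead^[k] d)) := by
    refine hs.induction (p := fun x => ∃ k, x = M.ahead^[k] d ∨ x = M.rot (M.rot (M.ahead^[k] d)))
      ?_ ?_ ⟨0, .inl rfl⟩
    · rintro x ⟨k, rfl | rfl⟩
      · exact ⟨k + 1, .inr (by rw [iterate_succ_apply', glue_ahead])⟩
      · obtain ⟨j, hj⟩ := hback k
        exact ⟨j, .inl hj⟩
    · rintro x ⟨k, rfl | rfl⟩
      · exact ⟨k, .inr rfl⟩
      · exact ⟨k, .inl (M.rot_four _)⟩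
  obtain ⟨k, rfl | rfl⟩ := hr
  · exact ⟨k, hF (M.edge_mem_border.2 hd')⟩
  · obtain ⟨j, hj⟩ := hback k
    exact ⟨j, hF (by rw [← hj, hd']; exact M.edge_mem_border.2 hd')⟩

theorem rot_above_iterate (d : D) (i : ℕ) : M.rot (M.above^[i] d) = M.ahead^[i] (M.rot d) := by
  induction i with
  | zero => rfl
  | succ i ih => rw [iterate_succ_apply', iterate_succ_apply', ← ih]; rfl

theorem IsFlat.exists_isGrid_of_corner [Finite D] (hM : M.IsStringSet) (hF : M.border ⊆ F)
    (hf : M.IsFlat F) {c : D} (hl : M.edge (M.rot (M.rot c)) ∈ F)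
    (hd : M.edge (M.rot (M.rot (M.rot c))) ∈ F) :
    ∃ n m, 0 < n ∧ 0 < m ∧ M.IsGrid F n m (fun i j => M.above^[i] (M.ahead^[j] c)) := by
  classical
  have hm := exists_ahead_iterate_mem hM hF c
  have hn := exists_ahead_iterate_mem hM hF (M.rot c)
  obtain ⟨m, hmF, hmin⟩ : ∃ m, M.edge (M.ahead^[m] c) ∈ F ∧ ∀ k < m, M.edge (M.ahead^[k] c) ∉ F :=
    ⟨Nat.find hm, Nat.find_spec hm, fun _ => Nat.find_min hm⟩
  obtain ⟨n, hnF, hnin⟩ : ∃ n, M.edge (M.rot (M.above^[n] c)) ∈ F ∧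
      ∀ k < n, M.edge (M.rot (M.above^[k] c)) ∉ F := by
    simp only [rot_above_iterate]
    exact ⟨Nat.find hn, Nat.find_spec hn, fun _ => Nat.find_min hn⟩
  clear hm hn
  set g : ℕ → ℕ → D := fun i j => M.above^[i] (M.ahead^[j] c) with hg
  have gup : ∀ i j, g (i + 1) j = M.above (g i j) := fun i j => iterate_succ_apply' _ _ _
  have eq_ahead : ∀ x y, M.glue x = M.rot (M.rot y) → y = M.ahead x := by
    intro x y h; rw [ahead, h, M.rot_four]
  -- The upper edges along a row are all free or all in `F`, so the height found over column `0`
  -- holds for every column.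
  have top : ∀ i, (∀ j < m, M.edge (g i j) ∉ F ∧ M.glue (g i j) = M.rot (M.rot (g i (j + 1)))) →
      ∀ j ≤ m, (M.edge (M.rot (g i j)) ∉ F ↔ M.edge (M.rot (g i 0)) ∉ F) := by
    intro i h j
    induction j with
    | zero => intro _; rfl
    | succ j ih =>
      intro hj
      rw [← ih (by omega), eq_ahead _ _ (h j (by omega)).2]
      exact hf.rot_ahead_iff (h j (by omega)).1
  have row : ∀ i ≤ n,
      (∀ j < m, M.edge (g i j) ∉ F ∧ M.glue (g i j) = M.rot (M.rot (g i (j + 1)))) ∧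
      M.edge (g i m) ∈ F ∧ M.edge (M.rot (M.rot (g i 0))) ∈ F := by
    intro i
    induction i with
    | zero =>
      refine fun _ => ⟨fun j hj => ⟨hmin j hj, ?_⟩, hmF, hl⟩
      simp only [hg, iterate_zero, id, iterate_succ_apply', ahead, M.rot_four]
    | succ i ih =>
      intro hi
      obtain ⟨h1, h2, h3⟩ := ih (by omega)
      have ht : ∀ j ≤ m, M.edge (M.rot (g i j)) ∉ F :=
        fun j hj => (top i h1 j hj).2 (hnin i (by omega))
      simp only [gup]
      refine ⟨fun j hj => ?_, hf.above_mem h2 (ht m le_rfl),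
        hf.left_above_mem h3 (ht 0 (by omega))⟩
      rw [eq_ahead _ _ (h1 j hj).2]
      exact hf.above_ahead (h1 j hj).1 (ht j hj.le)
  refine ⟨n + 1, m + 1, by omega, by omega, ?_⟩
  refine ⟨fun i j hi hj => ((row i (by omega)).1 j (by omega)).2, fun i j hi hj => ?_,
    fun i j hi hj => ((row i (by omega)).1 j (by omega)).1, fun i j hi hj => ?_,
    fun i j hi hj => ?_, fun i j hi hj => ?_, fun i hi _ => (row i (by omega)).2.2, fun j _ => ?_⟩
  · rw [gup, above, M.rot_four]
  · exact (top i (row i (by omega)).1 j (by omega)).2 (hnin i (by omega))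
  · rw [show j = m by omega]
    exact (row i (by omega)).2.1
  · rw [show i = n by omega]
    by_contra h
    exact (top n (row n le_rfl).1 j (by omega)).1 h hnF
  · induction j with
    | zero => intro _; exact hd
    | succ j ih =>
      intro hj
      have h := (row 0 (by omega)).1 j (by omega)
      by_contra hc
      -- Read the bottom row backwards: to the left of the reversed dart lies the lower side.
      refine hf.rot_ahead_iff (d := M.glue (g 0 j)) (by rw [edge_glue]; exact h.1) |>.2 ?_ ?_
      · rw [h.2]; exact hc
      · rw [ahead, M.glue_glue]
        exact ih (by omega)

/-- Being tiled passes through free edges, so it suffices to reach a corner: follow the string to an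
edge of `F`, then follow that side to its end. -/
theorem IsFlat.isTiled [Finite D] (hM : M.IsStringSet) (hF : M.border ⊆ F) (hf : M.IsFlat F)
    (d : D) : M.IsTiled F d := by
  have corner : ∀ d, M.edge (M.rot (M.rot d)) ∈ F → M.edge (M.rot (M.rot (M.rot d))) ∈ F →
      M.IsTiled F d := by
    intro d h1 h2
    obtain ⟨n, m, hn, hm, hg⟩ := hf.exists_isGrid_of_corner hM hF h1 h2
    exact ⟨_, n, m, _, hg, hg.squaresDistinct hf hF, rfl, 0, hn, 0, hm, rfl⟩
  have side : ∀ b d, M.edge (M.rot (M.rot d)) ∈ F →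
      M.edge (M.ahead^[b] (M.rot (M.rot (M.rot d)))) ∈ F → M.IsTiled F d := by
    intro b
    induction b with
    | zero => exact corner
    | succ b ih =>
      intro d h1 h2
      by_cases hb : M.edge (M.rot (M.rot (M.rot d))) ∈ F
      · exact corner d h1 hb
      · have ht : M.IsTiled F (M.rot (M.rot (M.rot (M.glue (M.rot (M.rot (M.rot d))))))) := by
          refine ih _ ?_ ?_
          · rw [M.rot_four]
            exact hf.above_mem (d := M.rot (M.rot d)) h1 hb
          · simpa [iterate_succ_apply, ahead, M.rot_four] using h2
        have := (ht.rot).glue (by rwa [M.rot_four, edge_glue])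
        rw [M.rot_four, M.glue_glue] at this
        simpa [M.rot_four] using this.rot
  have line : ∀ a d, M.edge (M.ahead^[a] d) ∈ F → M.IsTiled F d := by
    intro a
    induction a with
    | zero =>
      intro d h
      obtain ⟨b, hb⟩ := exists_ahead_iterate_mem hM hF (M.rot (M.rot (M.rot (M.rot (M.rot d)))))
      have := side b (M.rot (M.rot d)) (by simpa [M.rot_four] using h) hb
      simpa [M.rot_four] using this.rot.rot
    | succ a ih =>
      intro d h
      by_cases hd : M.edge d ∈ F
      · obtain ⟨b, hb⟩ := exists_ahead_iterate_mem hM hF (M.rot (M.rot (M.rot (M.rot (M.rot d)))))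
        have := side b (M.rot (M.rot d)) (by simpa [M.rot_four] using hd) hb
        simpa [M.rot_four] using this.rot.rot
      · have := (ih (M.ahead d) h).rot.rot
        rw [ahead, M.rot_four] at this
        simpa [M.glue_glue] using this.glue (by rwa [edge_glue])
  obtain ⟨a, ha⟩ := exists_ahead_iterate_mem hM hF d
  exact line a d ha

/-! ### Rectangles and grids -/

/-- The rectangle is a grid whose inner edges are not in `F` and whose outer edges are in `F`. -/
def Rectangle.IsBoundedBy (R : M.Rectangle) (F : Set M.Edge) : Prop :=
  ∃ g, M.IsGrid F R.rows R.cols g ∧ M.SquaresDistinct R.rows R.cols g ∧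
    ∀ i j, R.cell i j = g i j

theorem IsTiledBy.exists_rectangle {A : Set M.Square} {d : D} (h : M.IsTiledBy F A d) :
    ∃ R : M.Rectangle, R.IsBoundedBy F ∧ R.squares = A := by
  obtain ⟨n, m, g, hg, hs, rfl, i, hi, j, hj, rfl⟩ := h
  refine ⟨⟨n, m, by omega, by omega, fun i j => g i j, ?_, ?_, ?_⟩, ⟨g, hg, hs, fun _ _ => rfl⟩, ?_⟩
  · intro i j i' j' he
    have := hs _ _ _ _ i.2 j.2 i'.2 j'.2 he
    exact ⟨Fin.ext this.1, Fin.ext this.2⟩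
  · intro i j j' hj
    rw [hj]
    exact hg.right _ _ i.2 (hj ▸ j'.2)
  · intro i i' j hi
    rw [hi]
    exact hg.up _ _ (hi ▸ i'.2) j.2
  · ext s
    constructor
    · rintro ⟨i, j, rfl⟩
      exact ⟨i, i.2, j, j.2, rfl⟩
    · rintro ⟨i, hi, j, hj, rfl⟩
      exact ⟨⟨i, hi⟩, ⟨j, hj⟩, rfl⟩

theorem Rectangle.IsBoundedBy.isTiledBy {R : M.Rectangle} (h : R.IsBoundedBy F) {d : D}
    (hd : M.square d ∈ R.squares) : M.IsTiledBy F R.squares d := by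
  obtain ⟨i, j, hd⟩ := hd
  obtain ⟨g, hg, hs, hc⟩ := h
  refine IsTiledBy.of_square_eq ⟨_, _, g, hg, hs, ?_, i, i.2, j, j.2, (hc i j).symm⟩ hd.symm
  ext s
  constructor
  · rintro ⟨i, hi, j, hj, rfl⟩
    exact ⟨⟨i, hi⟩, ⟨j, hj⟩, by rw [hc]⟩
  · rintro ⟨i, j, rfl⟩
    exact ⟨i, i.2, j, j.2, by rw [hc]⟩

/-- An edge of a rectangle is inner if and only if it has a neighbour in the grid on each side. -/
theorem Rectangle.edge_mem_inner_iff (R : M.Rectangle) {d : D} :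
    M.edge d ∈ R.inner ↔ ∃ (i : Fin R.rows) (j : Fin R.cols),
      d = R.cell i j ∧ j.val + 1 < R.cols ∨
      d = M.rot (R.cell i j) ∧ i.val + 1 < R.rows ∨
      d = M.rot (M.rot (R.cell i j)) ∧ 0 < j.val ∨
      d = M.rot (M.rot (M.rot (R.cell i j))) ∧ 0 < i.val := by
  constructor
  · rintro (⟨i, j, j', hj, he⟩ | ⟨i, i', j, hi, he⟩)
    · rcases M.edge_eq he.symm with rfl | rfl
      · exact ⟨i, j, .inl ⟨rfl, hj ▸ j'.2⟩⟩
      · exact ⟨i, j', .inr (.inr (.inl ⟨R.horizontal i j j' hj, by omega⟩))⟩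
    · rcases M.edge_eq he.symm with rfl | rfl
      · exact ⟨i, j, .inr (.inl ⟨rfl, hi ▸ i'.2⟩)⟩
      · exact ⟨i', j, .inr (.inr (.inr ⟨R.vertical i i' j hi, by omega⟩))⟩
  · rintro ⟨i, j, ⟨rfl, h⟩ | ⟨rfl, h⟩ | ⟨rfl, h⟩ | ⟨rfl, h⟩⟩
    · exact .inl ⟨i, j, ⟨j + 1, h⟩, rfl, rfl⟩
    · exact .inr ⟨i, ⟨i + 1, h⟩, j, rfl, rfl⟩
    · have hj : j.val = (⟨j - 1, by omega⟩ : Fin R.cols).val + 1 := by simp; omega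
      refine .inl ⟨i, _, j, hj, ?_⟩
      rw [← R.horizontal i _ j hj, edge_glue]
    · have hi : i.val = (⟨i - 1, by omega⟩ : Fin R.rows).val + 1 := by simp; omega
      refine .inr ⟨_, i, j, hi, ?_⟩
      rw [← R.vertical _ i j hi, edge_glue]

theorem Rectangle.square_mem_of_edge_mem_inner {R : M.Rectangle} {d : D}
    (h : M.edge d ∈ R.inner) : M.square d ∈ R.squares := by
  obtain ⟨i, j, ⟨rfl, -⟩ | ⟨rfl, -⟩ | ⟨rfl, -⟩ | ⟨rfl, -⟩⟩ := R.edge_mem_inner_iff.1 h <;>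
  exact ⟨i, j, by simp only [square_rot]⟩

theorem Rectangle.glue_ne_of_edge_mem_inner {R : M.Rectangle} {d : D}
    (h : M.edge d ∈ R.inner) : M.glue d ≠ d := by
  intro hd
  have key : ∀ a, M.glue a = a → M.edge d = M.edge a → d = a := by
    intro a ha he
    rcases M.edge_eq he with h | h
    · exact h
    · rw [h, ha]
  rcases h with ⟨i, j, j', hj, he⟩ | ⟨i, i', j, hi, he⟩
  · have hg : M.glue (R.cell i j) = R.cell i j := by
      rcases M.edge_eq he with h | h
      · rw [h, hd]
      · rw [h, hd, hd]
    have hh := R.horizontal i j j' hj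
    rw [hg] at hh
    have := (R.distinct i j i j' (by rw [hh]; simp only [square_rot])).2
    omega
  · have hg : M.glue (M.rot (R.cell i j)) = M.rot (R.cell i j) := by
      rcases M.edge_eq he with h | h
      · rw [h, hd]
      · rw [h, hd, hd]
    have hh := R.vertical i i' j hi
    rw [hg] at hh
    have := (R.distinct i j i' j (by rw [← M.square_rot, hh]; simp only [square_rot])).1
    omega

theorem Rectangle.IsBoundedBy.edge_mem_inner_iff {R : M.Rectangle} (h : R.IsBoundedBy F) {d : D}
    (hd : M.square d ∈ R.squares) : M.edge d ∈ R.inner ↔ M.edge d ∉ F := by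
  obtain ⟨g, hg, hs, hc⟩ := h
  rw [R.edge_mem_inner_iff]
  constructor
  · rintro ⟨i, j, ⟨rfl, h⟩ | ⟨rfl, h⟩ | ⟨rfl, h⟩ | ⟨rfl, h⟩⟩ <;> rw [hc]
    exacts [(hg.right_iff i.2 j.2).2 h, (hg.up_iff i.2 j.2).2 h, (hg.left_iff i.2 j.2).2 h,
      (hg.down_iff i.2 j.2).2 h]
  · intro hF
    obtain ⟨i, j, he⟩ := hd
    refine ⟨i, j, ?_⟩
    rcases M.square_eq he.symm with h | h | h | h <;> rw [h, hc] at hF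
    exacts [.inl ⟨h, (hg.right_iff i.2 j.2).1 hF⟩, .inr (.inl ⟨h, (hg.up_iff i.2 j.2).1 hF⟩),
      .inr (.inr (.inl ⟨h, (hg.left_iff i.2 j.2).1 hF⟩)),
      .inr (.inr (.inr ⟨h, (hg.down_iff i.2 j.2).1 hF⟩))]

/-- The side of the square of `cell i j` in a given direction is inner only if there is a neighbour
in this direction. -/
theorem Rectangle.edge_rot_mem_inner (R : M.Rectangle) (i : Fin R.rows) (j : Fin R.cols) :
    (M.edge (R.cell i j) ∈ R.inner → j.val + 1 < R.cols) ∧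
    (M.edge (M.rot (R.cell i j)) ∈ R.inner → i.val + 1 < R.rows) ∧
    (M.edge (M.rot (M.rot (R.cell i j))) ∈ R.inner → 0 < j.val) ∧
    (M.edge (M.rot (M.rot (M.rot (R.cell i j)))) ∈ R.inner → 0 < i.val) := by
  have h2 := M.rot_two_ne
  have h1 := M.rot_ne
  have h3 : ∀ d, M.rot (M.rot (M.rot d)) ≠ d := fun d h => M.rot_ne d (by
    conv_rhs => rw [← M.rot_four d, h])
  have h1' := fun d => (h1 d).symm
  have h2' := fun d => (h2 d).symm
  have h3' := fun d => (h3 d).symm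
  -- Distinctness of the squares identifies the cell; then the four darts at its crossing are
  -- distinct, and only the matching direction survives.
  refine ⟨?_, ?_, ?_, ?_⟩ <;> intro h <;>
  obtain ⟨i', j', ⟨he, h⟩ | ⟨he, h⟩ | ⟨he, h⟩ | ⟨he, h⟩⟩ := R.edge_mem_inner_iff.1 h <;>
  obtain ⟨rfl, rfl⟩ := R.distinct i j i' j' (by simpa only [square_rot] using congrArg M.square he) <;>
  first
  | exact h
  | simp only [h1, h2, h3, h1', h2', h3'] at he

theorem Rectangle.isBoundedBy_of_edge_mem_iff {R : M.Rectangle}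
    (h : ∀ d, M.square d ∈ R.squares → (M.edge d ∈ F ↔ M.edge d ∉ R.inner)) :
    R.IsBoundedBy F := by
  -- The value outside the range is arbitrary.
  set g : ℕ → ℕ → D := fun i j => if h : i < R.rows ∧ j < R.cols then R.cell ⟨i, h.1⟩ ⟨j, h.2⟩
    else R.cell ⟨0, R.rows_pos⟩ ⟨0, R.cols_pos⟩ with hg
  have gc : ∀ {i j} (hi : i < R.rows) (hj : j < R.cols), g i j = R.cell ⟨i, hi⟩ ⟨j, hj⟩ :=
    fun hi hj => dif_pos ⟨hi, hj⟩
  have hm : ∀ i j, M.square (R.cell i j) ∈ R.squares := fun i j => ⟨i, j, rfl⟩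
  have hr := R.edge_rot_mem_inner
  refine ⟨g, ⟨?_, ?_, ?_, ?_, ?_, ?_, ?_, ?_⟩, ?_, fun i j => (gc i.2 j.2).symm⟩
  · intro i j hi hj
    rw [gc hi (by omega), gc hi hj]
    exact R.horizontal _ _ _ rfl
  · intro i j hi hj
    rw [gc (by omega) hj, gc hi hj]
    exact R.vertical _ _ _ rfl
  · intro i j hi hj
    rw [gc hi (by omega), h _ (hm _ _), not_not]
    exact .inl ⟨_, _, ⟨j + 1, hj⟩, rfl, rfl⟩
  · intro i j hi hj
    rw [gc (by omega) hj, h _ (by simpa only [square_rot] using hm _ _), not_not]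
    exact .inr ⟨_, ⟨i + 1, hi⟩, _, rfl, rfl⟩
  · intro i j hi hj
    rw [gc hi (by omega), h _ (hm _ _)]
    exact fun hc => by simpa [hj] using (hr _ _).1 hc
  · intro i j hi hj
    rw [gc (by omega) hj, h _ (by simpa only [square_rot] using hm _ _)]
    exact fun hc => by simpa [hi] using (hr _ _).2.1 hc
  · intro i hi hj
    rw [gc hi hj, h _ (by simpa only [square_rot] using hm _ _)]
    exact fun hc => by simpa using (hr _ _).2.2.1 hc
  · intro j hi hj
    rw [gc hi hj, h _ (by simpa only [square_rot] using hm _ _)]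
    exact fun hc => by simpa using (hr _ _).2.2.2 hc
  · intro i j i' j' hi hj hi' hj' he
    rw [gc hi hj, gc hi' hj'] at he
    simpa using R.distinct _ _ _ _ he

theorem exists_rectangulation_of_isTiled {E₀ : Set M.Edge} (hE : Disjoint E₀ M.border)
    (h : ∀ d, M.IsTiled (E₀ ∪ M.border) d) :
    ∃ Rs, M.IsRectangulation Rs ∧ E₀ = M.separating Rs := by
  set F := E₀ ∪ M.border with hF
  -- Turning a rectangle gives a different `Rectangle` with the same squares, so exactly one is
  -- chosen for each set of squares.
  let T := {A : Set M.Square // ∃ R : M.Rectangle, R.IsBoundedBy F ∧ R.squares = A}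
  let c : T → M.Rectangle := fun A => A.2.choose
  have hc : ∀ A : T, (c A).IsBoundedBy F ∧ (c A).squares = A := fun A => A.2.choose_spec
  have hex : ∀ d, ∃ A : T, M.square d ∈ (c A).squares := by
    intro d
    obtain ⟨A, hA⟩ := h d
    refine ⟨⟨A, hA.exists_rectangle⟩, ?_⟩
    rw [(hc _).2]
    exact hA.square_mem
  refine ⟨Set.range c, ?_, ?_⟩
  · intro s
    obtain ⟨d, rfl⟩ := Quot.exists_rep s
    obtain ⟨A, hA⟩ := hex d
    refine ⟨c A, ⟨⟨A, rfl⟩, hA⟩, ?_⟩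
    rintro _ ⟨⟨A', rfl⟩, hA'⟩
    have := ((hc A').1.isTiledBy hA').unique ((hc A).1.isTiledBy hA)
    rw [(hc A).2, (hc A').2] at this
    rw [Subtype.ext this]
  · ext e
    obtain ⟨d, rfl⟩ := Quot.exists_rep e
    change M.edge d ∈ E₀ ↔ M.edge d ∈ M.separating _
    constructor
    · intro he
      refine ⟨fun hb => Set.disjoint_left.1 hE he hb, ?_⟩
      rintro _ ⟨A, rfl⟩ hi
      exact ((hc A).1.edge_mem_inner_iff (Rectangle.square_mem_of_edge_mem_inner hi)).1 hi (.inl he)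
    · rintro ⟨hb, hi⟩
      by_contra he
      obtain ⟨A, hA⟩ := hex d
      exact hi _ ⟨A, rfl⟩ (((hc A).1.edge_mem_inner_iff hA).2 fun h => h.elim he hb)

theorem IsRectangulation.isTiled {Rs : Set M.Rectangle} (h : M.IsRectangulation Rs) (d : D) :
    M.IsTiled (M.separating Rs ∪ M.border) d := by
  obtain ⟨R, ⟨hR, hd⟩, -⟩ := h (M.square d)
  refine ⟨_, (Rectangle.isBoundedBy_of_edge_mem_iff fun a ha => ?_).isTiledBy hd⟩
  constructor
  · rintro (hs | hb) hi
    · exact hs.2 R hR hi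
    · exact Rectangle.glue_ne_of_edge_mem_inner hi (M.edge_mem_border.1 hb)
  · intro hi
    by_cases hb : M.edge a ∈ M.border
    · exact .inr hb
    · refine .inl ⟨hb, fun R' hR' hi' => hi ?_⟩
      rwa [(h (M.square a)).unique ⟨hR, ha⟩
        ⟨hR', Rectangle.square_mem_of_edge_mem_inner hi'⟩]

theorem IsCutSet.disjoint_border {S : Set (List D)} (hS : M.IsCutSet S) :
    Disjoint (M.cutEdges S) M.border := by
  rw [Set.disjoint_left]
  rintro e ⟨p, hp, he⟩
  obtain ⟨d, hd, rfl⟩ := List.mem_map.1 he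
  exact (hS.isStraightPath p hp).interior d hd

theorem isSaturating_iff_exists_rectangulation [Finite D] (hM : M.IsStringSet)
    {S : Set (List D)} (hS : M.IsCutSet S) :
    M.IsSaturating S ↔ ∃ Rs : Set M.Rectangle, M.IsRectangulation Rs ∧ M.Delimits S Rs := by
  rw [IsSaturating, forall_saturates_iff_isFlat]
  constructor
  · intro hf
    exact exists_rectangulation_of_isTiled hS.disjoint_border
      (hf.isTiled hM Set.subset_union_right)
  · rintro ⟨Rs, hR, hd⟩
    rw [show M.cutEdges S = M.separating Rs from hd]
    exact isFlat_of_isTiled hR.isTiled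

/-! ### Pseudosegments -/

theorem SameString.glue (d : D) : M.SameString d (M.glue d) := .rel _ _ (.inl rfl)

theorem SameString.rot_rot (d : D) : M.SameString d (M.rot (M.rot d)) := .rel _ _ (.inr rfl)

theorem SameString.trans {a b c : D} (h : M.SameString a b) (h' : M.SameString b c) :
    M.SameString a c := Relation.EqvGen.trans _ _ _ h h'

theorem SameString.symm {a b : D} (h : M.SameString a b) : M.SameString b a :=
  Relation.EqvGen.symm _ _ h

theorem IsGrid.sameString_row (h : M.IsGrid F n m g) {i : ℕ} (hi : i < n) {j : ℕ} (hj : j < m) :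
    M.SameString (g i j) (g i 0) := by
  induction j with
  | zero => exact .refl _
  | succ j ih =>
    refine (SameString.rot_rot _).trans (SameString.symm ?_ |>.trans (ih (by omega)))
    rw [← h.right _ _ hi hj]
    exact .glue _

theorem IsGrid.sameString_col (h : M.IsGrid F n m g) {j : ℕ} (hj : j < m) {i : ℕ} (hi : i < n) :
    M.SameString (M.rot (g i j)) (M.rot (g 0 j)) := by
  induction i with
  | zero => exact .refl _
  | succ i ih =>
    refine (SameString.rot_rot _).trans (SameString.symm ?_ |>.trans (ih (by omega)))
    rw [← h.up _ _ hi hj]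
    exact .glue _

/-- No row of a grid closes up to a closed curve. -/
theorem IsGrid.glue_ne (h : M.IsGrid F n m g) (hs : M.SquaresDistinct n m g)
    (hM : M.IsStringSet) {i : ℕ} (hi : i < n) (hm : 0 < m) :
    M.glue (g i (m - 1)) ≠ M.rot (M.rot (g i 0)) := by
  intro hc
  have hnext : ∀ j < m, ∃ k < m, M.glue (g i j) = M.rot (M.rot (g i k)) := by
    intro j hj
    by_cases hjm : j + 1 < m
    · exact ⟨j + 1, hjm, h.right _ _ hi hjm⟩
    · obtain rfl : j = m - 1 := by omega
      exact ⟨0, hm, hc⟩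
  have hprev : ∀ j < m, ∃ k < m, M.glue (M.rot (M.rot (g i j))) = g i k := by
    intro j hj
    rcases j with _ | j
    · exact ⟨m - 1, by omega, by rw [← hc, M.glue_glue]⟩
    · exact ⟨j, by omega, by rw [← h.right _ _ hi hj, M.glue_glue]⟩
  have hne : ∀ j < m, ∀ k < m, g i j ≠ M.rot (M.rot (g i k)) := by
    intro j hj k hk he
    obtain ⟨-, rfl⟩ := hs i j i k hi hj hi hk (by rw [he, square_rot, square_rot])
    exact M.rot_two_ne _ he.symm
  obtain ⟨d, hd, hdd⟩ := hM.not_closed (g i 0)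
  -- The darts of the row and their reverses would exhaust the string, yet none of them is fixed by
  -- `glue`.
  have hr : ∃ j < m, d = g i j ∨ d = M.rot (M.rot (g i j)) := by
    refine hd.induction (p := fun x => ∃ j < m, x = g i j ∨ x = M.rot (M.rot (g i j)))
      ?_ ?_ ⟨0, hm, .inl rfl⟩
    · rintro x ⟨k, hk, rfl | rfl⟩
      · obtain ⟨l, hl, he⟩ := hnext k hk
        exact ⟨l, hl, .inr he⟩
      · obtain ⟨l, hl, he⟩ := hprev k hk
        exact ⟨l, hl, .inl he⟩
    · rintro x ⟨k, hk, rfl | rfl⟩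
      · exact ⟨k, hk, .inr rfl⟩
      · exact ⟨k, hk, .inl (M.rot_four _)⟩
  obtain ⟨j, hj, rfl | rfl⟩ := hr
  · obtain ⟨k, hk, he⟩ := hnext j hj
    exact hne j hj k hk (hdd.symm.trans he)
  · obtain ⟨k, hk, he⟩ := hprev j hj
    exact hne k hk j hj (he.symm.trans hdd)

/-- If no two strings cross more than once, then every interior edge with a square of a rectangle on
both sides is an inner edge of the rectangle. -/
theorem IsPseudosegments.edge_mem_inner (hp : M.IsPseudosegments) (hM : M.IsStringSet)
    {R : M.Rectangle} {d : D} (hd : M.square d ∈ R.squares)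
    (hd' : M.square (M.glue d) ∈ R.squares) (hne : M.glue d ≠ d) : M.edge d ∈ R.inner := by
  by_contra hin
  -- With this choice of `F`, the grid uniqueness and turning results apply to a single rectangle.
  have hR : R.IsBoundedBy R.innerᶜ := Rectangle.isBoundedBy_of_edge_mem_iff fun _ _ => Iff.rfl
  obtain ⟨n, m, g, hg, hs, hA, i, hi, j, hj, rfl⟩ := hR.isTiledBy hd
  rw [← hA] at hd'
  obtain ⟨i', hi', j', hj', he⟩ := hd'
  obtain rfl : j = m - 1 := by
    by_contra h
    exact hg.right_inner i j hi (by omega) hin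
  have hsame := SameString.glue (M := M) (g i (m - 1))
  -- Rows `i` and `i'` both cross the last column; if they lie on one string, these two crossings
  -- coincide.
  have hrow : M.SameString (g i (m - 1)) (g i' j') → i = i' := by
    intro h
    refine (hs i (m - 1) i' (m - 1) hi hj hi' hj (hp _ _ ?_ ?_)).1
    · exact h.trans ((hg.sameString_row hi' hj').trans (hg.sameString_row hi' hj).symm)
    · exact (hg.sameString_col hj hi).trans (hg.sameString_col hj hi').symm
  -- Otherwise row `i` and column `j'` lie on one string, which crosses itself at their common
  -- square.
  have hcross : ¬ M.SameString (g i (m - 1)) (M.rot (g i' j')) := by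
    intro h
    refine hM.simple (g i j') ?_
    exact ((hg.sameString_row hi hj').trans (hg.sameString_row hi hj).symm).trans
      (h.trans ((hg.sameString_col hj' hi').trans (hg.sameString_col hj' hi).symm))
  have hout : M.edge (M.glue (g i (m - 1))) ∈ R.innerᶜ := by rwa [edge_glue]
  -- The edge returns to the right, top, left or bottom side of a square. Right makes it its own
  -- partner, left closes the row, and the other two make a string cross itself.
  rcases M.square_eq he.symm with h | h | h | h <;> rw [h] at hsame hout
  · obtain rfl := hrow hsame
    obtain rfl : j' = m - 1 := by
      by_contra hc
      exact (hg.right_iff hi hj').2 (by omega) hout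
    exact hne h
  · exact hcross hsame
  · obtain rfl := hrow (hsame.trans (SameString.rot_rot _).symm)
    obtain rfl : j' = 0 := by
      by_contra hc
      exact (hg.left_iff hi hj').2 (by omega) hout
    exact hg.glue_ne hs hM hi (by omega) h
  · exact hcross (hsame.trans (SameString.rot_rot _).symm)

theorem IsPseudosegments.separating_eq (hp : M.IsPseudosegments) (hM : M.IsStringSet)
    {Rs : Set M.Rectangle} (hR : M.IsRectangulation Rs) :
    M.separating Rs = M.separatingParts (Rectangle.squares '' Rs) := by
  ext e
  constructor
  · rintro ⟨hb, hi⟩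
    obtain ⟨d, rfl⟩ := Quot.exists_rep e
    obtain ⟨R, ⟨hR1, hd⟩, -⟩ := hR (M.square d)
    obtain ⟨R', ⟨hR1', hd'⟩, -⟩ := hR (M.square (M.glue d))
    refine ⟨d, rfl, _, ⟨R, hR1, rfl⟩, _, ⟨R', hR1', rfl⟩, fun hc => ?_, hd, hd'⟩
    rw [← hc] at hd'
    exact hi R hR1 (hp.edge_mem_inner hM hd hd' fun h => hb (M.edge_mem_border.2 h))
  · rintro ⟨d, rfl, _, ⟨R, hR1, rfl⟩, _, ⟨R', hR1', rfl⟩, hne, hd, hd'⟩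
    have key : ∀ Q ∈ Rs, M.square d ∈ Q.squares → M.square (M.glue d) ∈ Q.squares → False := by
      intro Q hQ h h'
      rw [(hR _).unique ⟨hR1, hd⟩ ⟨hQ, h⟩, (hR _).unique ⟨hR1', hd'⟩ ⟨hQ, h'⟩] at hne
      exact hne rfl
    refine ⟨fun hb => key R hR1 hd ?_, fun Q hQ hi => key Q hQ ?_ ?_⟩
    · rwa [M.edge_mem_border.1 hb]
    · exact Rectangle.square_mem_of_edge_mem_inner hi
    · exact Rectangle.square_mem_of_edge_mem_inner (by rwa [edge_glue])

theorem IsRectangulation.isRectanglePartition {Rs : Set M.Rectangle} (h : M.IsRectangulation Rs) :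
    M.IsRectanglePartition (Rectangle.squares '' Rs) := by
  refine ⟨⟨?_, fun s => ?_⟩, ?_⟩
  · rintro ⟨R, -, hR⟩
    have : M.square (R.cell ⟨0, R.rows_pos⟩ ⟨0, R.cols_pos⟩) ∈ R.squares := ⟨_, _, rfl⟩
    rw [hR] at this
    exact this
  · obtain ⟨R, ⟨hR, hs⟩, huniq⟩ := h s
    refine ⟨R.squares, ⟨⟨R, hR, rfl⟩, hs⟩, ?_⟩
    rintro _ ⟨⟨Q, hQ, rfl⟩, hsQ⟩
    rw [huniq Q ⟨hQ, hsQ⟩]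
  · rintro _ ⟨R, -, rfl⟩
    exact ⟨R, rfl⟩

theorem IsRectanglePartition.exists_isRectangulation {P : Set (Set M.Square)}
    (h : M.IsRectanglePartition P) :
    ∃ Rs, M.IsRectangulation Rs ∧ Rectangle.squares '' Rs = P := by
  let c : P → M.Rectangle := fun A => (h.2 A A.2).choose
  have hc : ∀ A, (c A).squares = A := fun A => (h.2 A A.2).choose_spec
  refine ⟨Set.range c, fun s => ?_, ?_⟩
  · obtain ⟨A, ⟨hA, hs⟩, huniq⟩ := h.1.2 s
    refine ⟨c ⟨A, hA⟩, ⟨⟨⟨A, hA⟩, rfl⟩, by rwa [hc]⟩, ?_⟩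
    rintro _ ⟨⟨⟨B, hB⟩, rfl⟩, hsB⟩
    rw [hc] at hsB
    obtain rfl := huniq B ⟨hB, hsB⟩
    rfl
  · ext A
    constructor
    · rintro ⟨_, ⟨B, rfl⟩, rfl⟩
      rw [hc]
      exact B.2
    · exact fun hA => ⟨_, ⟨⟨A, hA⟩, rfl⟩, hc _⟩

end CrossingMap

theorem mainTheorem8 {D : Type*} [Finite D] (M : CrossingMap D) (hM : M.IsStringSet)
    (S : Set (List D)) (hS : M.IsCutSet S) :
    (M.IsSaturating S ↔
      ∃ Rs : Set M.Rectangle, M.IsRectangulation Rs ∧ M.Delimits S Rs) ∧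
    (M.IsPseudosegments →
      (M.IsSaturating S ↔
        ∃ P : Set (Set M.Square), M.IsRectanglePartition P ∧ M.DelimitsParts S P)) := by
  have hmain := CrossingMap.isSaturating_iff_exists_rectangulation hM hS
  refine ⟨hmain, fun hp => hmain.trans ⟨?_, ?_⟩⟩
  · rintro ⟨Rs, hR, hd⟩
    exact ⟨_, hR.isRectanglePartition, hd.trans (hp.separating_eq hM hR)⟩
  · rintro ⟨P, hP, hd⟩
    obtain ⟨Rs, hR, rfl⟩ := hP.exists_isRectangulation
    exact ⟨Rs, hR, hd.trans (hp.separating_eq hM hR).symm⟩
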